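/- All dimensions below take values in $[-1,\infty]$ and equal $-1$ for the empty space. $\dim_H$ denotes Hausdorff dimension, and $\dim_t$ denotes the small inductive topological dimension. For a metric space $X$ and $n\in\mathbb N$ the $n$th inductive topological Hausdorff dimension is defined by $\dim_{t^nH}\emptyset=-1$ and, for $X\neq\emptyset$, by $\dim_{t^0H}X=\dim_H X$ and, for $n\ge 1$, $$\dim_{t^nH}X=\inf\{d: X\text{ has a basis }\mathcal U\text{ such that }\dim_{t^{n-1}H}\partial U\le d-1\text{ for every }U\in\mathcal U\},$$ where $d$ ranges over the real numbers together with $\infty$ and $\infty-1=\infty$. A set $L\subseteq X$ is a partition between disjoint sets $A,B\subseteq X$ if $L=X\setminus(U\cup V)$ for some disjoint open sets $U\supseteq A$ and $V\supseteq B$. For $s>0$ let $\mathcal H^s_\infty(A)=\inf\{\sum_{i=1}^\infty(\operatorname{diam}U_i)^s: A\subseteq\bigcup_{i=1}^\infty U_i\}$ be the $s$-Hausdorff content. For a family $\mathcal V$ of sets (repetitions allowed) let $T_m(\mathcal V)$ be the set of points covered by at least $m$ members of $\mathcal V$. A refinement of a cover $\mathcal U$ of $X$ is a cover $\mathcal V$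 of $X$ each of whose members is contained in a member of $\mathcal U$. **Theorem.** Let $n\ge 1$ be an integer and let $X$ be a separable metric space with $\dim_t X\ge n$. Consider the following sets of real numbers $d$, to each of which the element $\infty$ is added: \begin{align*} P_{t^nH}&=\{d: X\text{ has a basis }\mathcal U\text{ such that }\dim_{t^{n-1}H}\partial U\le d-1\text{ for every }U\in\mathcal U\},\\ P_{d^nH}&=\{d\ge n: \text{there is } A\subseteq X\text{ such that }\dim_H A\le d-n\text{ and }\dim_t(X\setminus A)\le n-1\},\\ P_{p^nH}&=\{d\ge n: \text{for all pairs }(A_1,B_1),\dots,(A_n,B_n)\text{ of disjoint closed subsets of }X\\ &\qquad\text{there are partitions }L_i\text{ between }A_i\text{ and }B_i\text{ such that }\textstyle\dim_H\bigl(\bigcap_{i=1}^nL_i\bigr)\le d-n\},\\ P_{c^nH}&=\{d\ge n: \text{for every }\varepsilon>0\text{ and every finite open cover }\mathcal U\text{ of }X\text{ there is a finite open}\\ &\qquad\text{refinement }\mathcal V\text{ of }\mathcal U\text{ such that }\mathcal H^{d-n+\varepsilon}_\infty(T_{n+1}(\mathcal V))\le\varepsilon\}. \end{align*} Then each of these four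 sets has a minimum, and $$\dim_{t^nH}X=\min P_{t^nH}=\min P_{d^nH}=\min P_{p^nH}=\min P_{c^nH}.$$ -/

import Mathlib

open Set TopologicalSpace
open scoped ENNReal

universe u

/-- The (small inductive) topological dimension as an extended real number, with the
convention that the empty space has dimension `-1` (Mathlib's convention is `⊥`). -/
noncomputable def topDim (X : Type u) [TopologicalSpace X] : EReal :=
  WithBot.recBotCoe (-1 : EReal) (fun k : ℕ∞ => ((k : ℝ≥0∞) : EReal)) (smallInductiveDimension X)

open Classical in
/-- The Hausdorff dimension of a subset of a metric space, with the convention that the empty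
set has dimension `-1` (Mathlib's convention is `0`). -/
noncomputable def hausdorffDim {X : Type u} [MetricSpace X] (A : Set X) : EReal :=
  if A = ∅ then -1 else (dimH A : EReal)

open Classical in
/-- The `n`th inductive topological Hausdorff dimension of a metric space. -/
noncomputable def indTopHausdorffDim : ℕ → (X : Type u) → [MetricSpace X] → EReal
  | 0, X, _ => hausdorffDim (univ : Set X)
  | n + 1, X, _ =>
    if IsEmpty X then -1
    else sInf {d : EReal | ∃ 𝓤 : Set (Set X), IsTopologicalBasis 𝓤 ∧
      ∀ U ∈ 𝓤, indTopHausdorffDim n (frontier U) ≤ d - 1}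

/-- The `s`-Hausdorff content of a set (only used for `s > 0`, so that sets of
diameter zero contribute `0`). -/
noncomputable def hausdorffContent {X : Type u} [MetricSpace X] (s : ℝ) (A : Set X) : ℝ≥0∞ :=
  ⨅ (U : ℕ → Set X) (_ : A ⊆ ⋃ i, U i), ∑' i, Metric.ediam (U i) ^ s

/-- `L` is a partition between `A` and `B`. -/
def IsPartitionBetween {X : Type u} [TopologicalSpace X] (A B L : Set X) : Prop :=
  ∃ U V : Set X, IsOpen U ∧ IsOpen V ∧ A ⊆ U ∧ B ⊆ V ∧ U ∩ V = ∅ ∧ L = (U ∪ V)ᶜ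

/-- The indexed family `𝓤` is an open cover of `X`. -/
def IsOpenCoverFamily {X : Type u} [TopologicalSpace X] {ι : Type*} (𝓤 : ι → Set X) : Prop :=
  (∀ i, IsOpen (𝓤 i)) ∧ ⋃ i, 𝓤 i = univ

/-- The set of points covered by at least `m` members of the indexed family `𝓥`
(repeated members are counted with multiplicity). -/
def multiplyCovered {X : Type u} {ι : Type*} (m : ℕ) (𝓥 : ι → Set X) : Set X :=
  {x | (m : ℕ∞) ≤ {i | x ∈ 𝓥 i}.encard}

/-- The parameters `d` (real or `∞`) admitted in the definition of the `n`th inductive topological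
Hausdorff dimension, for `n ≥ 1`. -/
def paramTop (n : ℕ) (X : Type u) [MetricSpace X] : Set EReal :=
  {d | d = ⊤ ∨ ∃ 𝓤 : Set (Set X), IsTopologicalBasis 𝓤 ∧
    ∀ U ∈ 𝓤, indTopHausdorffDim (n - 1) (frontier U) ≤ d - 1}

/-- The decomposition parameters. -/
def paramDecomp (n : ℕ) (X : Type u) [MetricSpace X] : Set EReal :=
  {d | d = ⊤ ∨ ((n : EReal) ≤ d ∧ ∃ A : Set X,
    hausdorffDim A ≤ d - n ∧ topDim (Aᶜ : Set X) ≤ (n : EReal) - 1)}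

/-- The partition parameters. -/
def paramPart (n : ℕ) (X : Type u) [MetricSpace X] : Set EReal :=
  {d | d = ⊤ ∨ ((n : EReal) ≤ d ∧ ∀ A B : Fin n → Set X,
    (∀ i, IsClosed (A i)) → (∀ i, IsClosed (B i)) → (∀ i, A i ∩ B i = ∅) →
    ∃ L : Fin n → Set X, (∀ i, IsPartitionBetween (A i) (B i) (L i)) ∧
      hausdorffDim (⋂ i, L i) ≤ d - n)}

/-- The covering parameters. -/
def paramCover (n : ℕ) (X : Type u) [MetricSpace X] : Set EReal :=
  {d | d = ⊤ ∨ ∃ r : ℝ, d = (r : EReal) ∧ (n : ℝ) ≤ r ∧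
    ∀ ε : ℝ, 0 < ε → ∀ (k : ℕ) (𝓤 : Fin k → Set X), IsOpenCoverFamily 𝓤 →
      ∃ (l : ℕ) (𝓥 : Fin l → Set X), IsOpenCoverFamily 𝓥 ∧ (∀ j, ∃ i, 𝓥 j ⊆ 𝓤 i) ∧
        hausdorffContent (r - n + ε) (multiplyCovered (n + 1) 𝓥) ≤ ENNReal.ofReal ε}

open MeasureTheory Filter Topology

/-! All four conditions are compared through `AlmostPartitionable n μ univ`, where `μ` is the
`s`-Hausdorff content, `s > r` is arbitrary, and `d = n + r`.

Each condition at level `n + r` implies it. For bases, induct on `n`: one partition fits inside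
countably many frontiers of basis elements, and the other pairs are treated on those frontiers. A
decomposition yields partitions whose common part lies in its set of Hausdorff dimension at most
`r`, and such a set has content zero for `s > r`. For covers, a partition of unity maps the space to
`ℝⁿ`, and the level sets of a point in general position meet only where more than `n` members
overlap.

Conversely, content is outer regular: a small common part has a small open neighbourhood, so the
pairs can be enlarged until smallness holds for every later choice of partitions. Hence countably
many requirements can be met at once (`exists_partitions_of_almostPartitionable`). Applied to
countably many separating pairs, this gives `HasDimDecomposition n r X`
(`HasDimDecomposition.of_almostPartitionable`), from which all four conditions at `n + r` follow. As
only exponents `s > r` are used, the value `r` itself is reached, so the infima are attained. -/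

/-! ### Outer regularity and Hausdorff content -/

/-- An outer measure is outer regular if sets can be approximated by open supersets. -/
def OpenRegular {X : Type u} [TopologicalSpace X] (μ : OuterMeasure X) : Prop :=
  ∀ (A : Set X) (ε : ℝ≥0∞), ε ≠ 0 → ∃ G, IsOpen G ∧ A ⊆ G ∧ μ G ≤ μ A + ε

/-- For `⊤`, finite measure means empty. This lets exact partition theorems for topological
dimension share the argument used for Hausdorff content. -/
theorem openRegular_top {X : Type u} [TopologicalSpace X] :
    OpenRegular (⊤ : OuterMeasure X) := by
  intro A ε _
  rcases A.eq_empty_or_nonempty with rfl | h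
  · exact ⟨∅, isOpen_empty, subset_rfl, by simp⟩
  · exact ⟨univ, isOpen_univ, subset_univ _, by simp [OuterMeasure.top_apply h]⟩

/-- The `s`-Hausdorff content as an outer measure. -/
noncomputable def contentMeasure (X : Type u) [MetricSpace X] (s : ℝ) (hs : 0 < s) :
    OuterMeasure X :=
  OuterMeasure.ofFunction (fun U => Metric.ediam U ^ s) (by simp [hs])

theorem contentMeasure_apply {X : Type u} [MetricSpace X] {s : ℝ} (hs : 0 < s) (A : Set X) :
    contentMeasure X s hs A = hausdorffContent s A := by
  rw [contentMeasure, OuterMeasure.ofFunction_apply, hausdorffContent]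

theorem hausdorffContent_le_tsum {X : Type u} [MetricSpace X] {s : ℝ} {A : Set X}
    {U : ℕ → Set X} (h : A ⊆ ⋃ i, U i) :
    hausdorffContent s A ≤ ∑' i, Metric.ediam (U i) ^ s :=
  iInf₂_le U h

theorem exists_cover_of_hausdorffContent_lt {X : Type u} [MetricSpace X] {s : ℝ} {A : Set X}
    {c : ℝ≥0∞} (h : hausdorffContent s A < c) :
    ∃ U : ℕ → Set X, A ⊆ ⋃ i, U i ∧ ∑' i, Metric.ediam (U i) ^ s < c := by
  simpa [hausdorffContent, iInf_lt_iff] using h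

theorem exists_open_superset_ediam_rpow {X : Type u} [MetricSpace X] {s : ℝ} (hs : 0 < s)
    (A : Set X) {ε : ℝ≥0∞} (hε : ε ≠ 0) :
    ∃ G, IsOpen G ∧ A ⊆ G ∧ Metric.ediam G ^ s ≤ Metric.ediam A ^ s + ε := by
  by_cases hA : Metric.ediam A = ∞
  · exact ⟨univ, isOpen_univ, subset_univ _, by simp [hA, ENNReal.top_rpow_of_pos hs]⟩
  have hcont : Continuous fun δ : NNReal => (Metric.ediam A + 2 * (δ : ℝ≥0∞)) ^ s :=
    ENNReal.continuous_rpow_const.comp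
      (continuous_const.add ((ENNReal.continuous_const_mul (by simp)).comp
        ENNReal.continuous_coe))
  have hlt : (Metric.ediam A + 2 * ((0 : NNReal) : ℝ≥0∞)) ^ s < Metric.ediam A ^ s + ε := by
    simpa using ENNReal.lt_add_right (ENNReal.rpow_ne_top_of_nonneg hs.le hA) hε
  have hev : ∀ᶠ δ : NNReal in 𝓝[>] 0,
      (Metric.ediam A + 2 * (δ : ℝ≥0∞)) ^ s < Metric.ediam A ^ s + ε :=
    (hcont.tendsto 0).eventually_lt_const hlt |>.filter_mono nhdsWithin_le_nhds
  obtain ⟨δ, hδ, hδ0⟩ := (hev.and self_mem_nhdsWithin).exists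
  refine ⟨Metric.thickening δ A, Metric.isOpen_thickening,
    Metric.self_subset_thickening (by exact_mod_cast hδ0) A, ?_⟩
  exact (ENNReal.rpow_le_rpow (Metric.ediam_thickening_le δ) hs.le).trans hδ.le

theorem openRegular_contentMeasure {X : Type u} [MetricSpace X] {s : ℝ} (hs : 0 < s) :
    OpenRegular (contentMeasure X s hs) := by
  intro A ε hε
  rw [contentMeasure_apply]
  by_cases hA : hausdorffContent s A = ∞
  · exact ⟨univ, isOpen_univ, subset_univ _, by simp [hA]⟩
  have hε2 : ε / 2 ≠ 0 := by simpa using hε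
  obtain ⟨U, hU, hsum⟩ := exists_cover_of_hausdorffContent_lt (ENNReal.lt_add_right hA hε2)
  obtain ⟨δ, hδ, hδsum⟩ := ENNReal.exists_pos_sum_of_countable' hε2 ℕ
  choose G hGo hUG hG using fun i => exists_open_superset_ediam_rpow hs (U i) (hδ i).ne'
  refine ⟨⋃ i, G i, isOpen_iUnion hGo, hU.trans (iUnion_mono hUG), ?_⟩
  rw [contentMeasure_apply]
  calc hausdorffContent s (⋃ i, G i) ≤ ∑' i, Metric.ediam (G i) ^ s :=
        hausdorffContent_le_tsum subset_rfl
    _ ≤ ∑' i, (Metric.ediam (U i) ^ s + δ i) := ENNReal.tsum_le_tsum hG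
    _ = (∑' i, Metric.ediam (U i) ^ s) + ∑' i, δ i := ENNReal.tsum_add
    _ ≤ (hausdorffContent s A + ε / 2) + ε / 2 := add_le_add hsum.le hδsum.le
    _ = hausdorffContent s A + ε := by rw [add_assoc, ENNReal.add_halves]

theorem contentMeasure_image_coe_le {X : Type u} [MetricSpace X] {s : ℝ} (hs : 0 < s)
    (F : Set X) (A : Set F) :
    contentMeasure X s hs ((↑) '' A) ≤ contentMeasure F s hs A := by
  rw [contentMeasure_apply, contentMeasure_apply]
  refine le_iInf₂ fun U hU => ?_
  refine (hausdorffContent_le_tsum (U := fun i => (↑) '' U i) ?_).trans_eq ?_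
  · rw [← image_iUnion]; exact image_mono hU
  · simp [isometry_subtype_coe.ediam_image]

theorem hausdorffContent_eq_zero_of_dimH_lt {X : Type u} [MetricSpace X] {s : ℝ} (hs : 0 < s)
    {A : Set X} (h : dimH A < ENNReal.ofReal s) : hausdorffContent s A = 0 := by
  borelize X
  have h0 := hausdorffMeasure_of_dimH_lt (d := s.toNNReal) h
  rw [Real.coe_toNNReal s hs.le, Measure.hausdorffMeasure_apply] at h0
  have h1 := le_of_le_of_eq (le_iSup₂ (α := ℝ≥0∞) (1 : ℝ≥0∞) one_pos) h0
  refine le_antisymm (le_trans ?_ h1) bot_le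
  refine le_iInf fun U => le_iInf fun hU => le_iInf fun _ => ?_
  refine (hausdorffContent_le_tsum hU).trans (ENNReal.tsum_le_tsum fun i => ?_)
  rcases (U i).eq_empty_or_nonempty with hi | hi
  · simp [hi, hs]
  · simp [hi]

/-- The content puts no bound on diameters, but a sum below `ρ ^ s` forces every diameter to be at
most `ρ`. -/
theorem hausdorffMeasure_eq_zero_of_content {X : Type u} [MetricSpace X] [MeasurableSpace X]
    [BorelSpace X] {s : ℝ} (hs : 0 < s) {A : Set X} (h : hausdorffContent s A = 0) :
    Measure.hausdorffMeasure s A = 0 := by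
  rw [Measure.hausdorffMeasure_apply]
  refine le_antisymm (iSup₂_le fun ρ hρ => ?_) bot_le
  refine le_of_forall_gt_imp_ge_of_dense fun ε hε => ?_
  have hpos : hausdorffContent s A < min ε (ρ ^ s) := by
    rw [h]
    refine lt_min hε ?_
    rcases eq_or_ne ρ ∞ with rfl | hρt
    · simp [ENNReal.top_rpow_of_pos hs]
    · exact ENNReal.rpow_pos hρ hρt
  obtain ⟨U, hU, hsum⟩ := exists_cover_of_hausdorffContent_lt hpos
  refine iInf_le_of_le U (iInf_le_of_le hU (iInf_le_of_le (fun i => ?_) ?_))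
  · rw [← ENNReal.rpow_le_rpow_iff hs]
    exact (ENNReal.le_tsum i).trans (hsum.le.trans (min_le_right _ _))
  · refine le_trans (ENNReal.tsum_le_tsum fun i => iSup_le fun _ => le_rfl) ?_
    exact hsum.le.trans (min_le_left _ _)

theorem dimH_le_of_hausdorffContent_eq_zero {X : Type u} [MetricSpace X] {r : ℝ} (hr : 0 ≤ r)
    {A : Set X} (h : ∀ k : ℕ, hausdorffContent (r + 1 / (k + 1)) A = 0) :
    dimH A ≤ ENNReal.ofReal r := by
  borelize X
  have key : ∀ k : ℕ, dimH A ≤ ENNReal.ofReal (r + 1 / (k + 1)) := by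
    intro k
    have hk : 0 < r + 1 / ((k : ℝ) + 1) := by positivity
    refine dimH_le_of_hausdorffMeasure_ne_top (d := (r + 1 / ((k : ℝ) + 1)).toNNReal) ?_
    rw [Real.coe_toNNReal _ hk.le, hausdorffMeasure_eq_zero_of_content hk (h k)]
    simp
  refine ge_of_tendsto' (x := atTop) (ENNReal.tendsto_ofReal ?_) key
  simpa using (tendsto_const_nhds (x := r)).add (tendsto_one_div_add_atTop_nhds_zero_nat (𝕜 := ℝ))

/-- A sum below `1` forces all diameters to be at most `1`, and raising the exponent then decreases
every term. Without `c < 1` this breaks down. -/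
theorem hausdorffContent_le_of_le {X : Type u} [MetricSpace X] {s t : ℝ} (hs : 0 < s)
    (hst : s ≤ t) {A : Set X} {c : ℝ≥0∞} (hc : c < 1) (h : hausdorffContent s A ≤ c) :
    hausdorffContent t A ≤ c := by
  refine le_of_forall_gt_imp_ge_of_dense fun b hb => ?_
  obtain ⟨U, hU, hsum⟩ := exists_cover_of_hausdorffContent_lt (h.trans_lt (lt_min hb hc))
  refine (hausdorffContent_le_tsum hU).trans (le_trans (ENNReal.tsum_le_tsum fun i => ?_)
    (hsum.le.trans (min_le_left _ _)))
  have h1 : Metric.ediam (U i) ^ s ≤ 1 :=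
    (ENNReal.le_tsum i).trans (hsum.le.trans (min_le_right _ _))
  have h2 : Metric.ediam (U i) ≤ 1 := by
    rw [← ENNReal.rpow_le_rpow_iff hs]; simpa using h1
  exact ENNReal.rpow_le_rpow_of_exponent_ge h2 hst

/-! ### Partitions with small common part -/

/-- Any `n` pairs of disjoint closed sets admit partitions whose intersection has arbitrarily
small measure inside `F`. -/
def AlmostPartitionable {X : Type u} [TopologicalSpace X] (n : ℕ) (μ : OuterMeasure X)
    (F : Set X) : Prop :=
  ∀ ε : ℝ≥0∞, ε ≠ 0 → ∀ A B : Fin n → Set X,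
    (∀ i, IsClosed (A i)) → (∀ i, IsClosed (B i)) → (∀ i, A i ∩ B i = ∅) →
    ∃ L : Fin n → Set X, (∀ i, IsPartitionBetween (A i) (B i) (L i)) ∧
      μ (F ∩ ⋂ i, L i) ≤ ε

/-- Every pair of separated sets extends to a pair of disjoint open sets. -/
theorem exists_open_of_separated {X : Type u} [MetricSpace X] {S T : Set X}
    (h₁ : closure S ∩ T = ∅) (h₂ : S ∩ closure T = ∅) :
    ∃ U V : Set X, IsOpen U ∧ IsOpen V ∧ S ⊆ U ∧ T ⊆ V ∧ U ∩ V = ∅ := by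
  have h := completely_normal (disjoint_iff_inter_eq_empty.2 h₁) (disjoint_iff_inter_eq_empty.2 h₂)
  obtain ⟨U, V, hU, hV, hSU, hTV, hd⟩ := separatedNhds_iff_disjoint.2 h
  exact ⟨U, V, hU, hV, hSU, hTV, hd.inter_eq⟩

theorem exists_isPartitionBetween {X : Type u} [MetricSpace X] {A B : Set X}
    (hA : IsClosed A) (hB : IsClosed B) (hAB : A ∩ B = ∅) : ∃ L, IsPartitionBetween A B L := by
  obtain ⟨U, V, hU, hV, hAU, hBV, hd⟩ := exists_open_of_separated (S := A) (T := B)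
    (by rwa [hA.closure_eq]) (by rwa [hB.closure_eq])
  exact ⟨_, U, V, hU, hV, hAU, hBV, hd, rfl⟩

/-- Disjoint closed pairs can be enlarged to disjoint closed neighbourhoods so that the finitely
many gaps selected by `g` have small common part in `F`. -/
theorem AlmostPartitionable.exists_enlarge {X : Type u} [MetricSpace X] {n : ℕ}
    {μ : OuterMeasure X} {F : Set X} (h : AlmostPartitionable n μ F) (hμ : OpenRegular μ)
    (hF : IsClosed F) {J : Type*} {g : Fin n → J} (hg : Function.Injective g)
    {A B : J → Set X} (hA : ∀ j, IsClosed (A j)) (hB : ∀ j, IsClosed (B j))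
    (hAB : ∀ j, A j ∩ B j = ∅) {ε : ℝ≥0∞} (hε : ε ≠ 0) :
    ∃ A' B' : J → Set X, (∀ j, IsClosed (A' j)) ∧ (∀ j, IsClosed (B' j)) ∧
      (∀ j, A' j ∩ B' j = ∅) ∧ (∀ j, A j ⊆ interior (A' j)) ∧ (∀ j, B j ⊆ interior (B' j)) ∧
      μ (F ∩ ⋂ i, (A' (g i) ∪ B' (g i))ᶜ) ≤ ε := by
  have hε2 : ε / 2 ≠ 0 := by simpa using hε
  obtain ⟨L, hL, hμL⟩ := h (ε / 2) hε2 (A ∘ g) (B ∘ g) (fun i => hA _) (fun i => hB _)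
    (fun i => hAB _)
  choose U V hU hV hAU hBV hUV hLe using hL
  obtain ⟨G, hG, hLG, hμG⟩ := hμ (F ∩ ⋂ i, L i) (ε / 2) hε2
  have hGε : μ G ≤ ε := hμG.trans ((add_le_add_left hμL _).trans_eq (ENNReal.add_halves ε))
  -- Outside `G` the sides `U i`, `V i` cover `F`. Shrinking them to closed sets gives the pieces to
  -- add to `A` and `B`, so that the new gaps meet within `F` only inside `G`.
  obtain ⟨v, hvcov, hvcl, hvsub⟩ := exists_subset_iUnion_closed_subset
    (u := Sum.elim U V) (hF.inter hG.isClosed_compl) (by rintro (i | i); exacts [hU i, hV i])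
    (fun _ _ => Set.toFinite _) (by
      rintro x ⟨hxF, hxG⟩
      by_contra hx
      simp only [mem_iUnion, Sum.exists, Sum.elim_inl, Sum.elim_inr, not_or, not_exists] at hx
      refine hxG (hLG ⟨hxF, mem_iInter.2 fun i => ?_⟩)
      rw [hLe i]
      exact fun h => h.elim (hx.1 i) (hx.2 i))
  choose L₀ U₀ V₀ hU₀ hV₀ hAU₀ hBV₀ hUV₀ _ using
    fun j => exists_isPartitionBetween (hA j) (hB j) (hAB j)
  have key : ∀ j, ∃ P Q : Set X, IsClosed P ∧ IsClosed Q ∧ P ∩ Q = ∅ ∧ A j ⊆ interior P ∧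
      B j ⊆ interior Q ∧ ∀ i, g i = j → v (.inl i) ⊆ P ∧ v (.inr i) ⊆ Q := by
    intro j
    suffices H : ∃ (S T O W : Set X), IsClosed S ∧ IsClosed T ∧ IsOpen O ∧ IsOpen W ∧
        O ∩ W = ∅ ∧ A j ∪ S ⊆ O ∧ B j ∪ T ⊆ W ∧
        ∀ i, g i = j → v (.inl i) ⊆ S ∧ v (.inr i) ⊆ T by
      obtain ⟨S, T, O, W, hS, hT, hO, hW, hOW, hSO, hTW, hv⟩ := H
      obtain ⟨P, hP, hSP, hPO⟩ := normal_exists_closure_subset ((hA j).union hS) hO hSO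
      obtain ⟨Q, hQ, hTQ, hQW⟩ := normal_exists_closure_subset ((hB j).union hT) hW hTW
      refine ⟨closure P, closure Q, isClosed_closure, isClosed_closure,
        subset_empty_iff.1 (hOW ▸ inter_subset_inter hPO hQW),
        subset_union_left.trans (hSP.trans (interior_maximal subset_closure hP)),
        subset_union_left.trans (hTQ.trans (interior_maximal subset_closure hQ)),
        fun i hi => ⟨?_, ?_⟩⟩
      · exact (hv i hi).1.trans (subset_union_right.trans (hSP.trans subset_closure))
      · exact (hv i hi).2.trans (subset_union_right.trans (hTQ.trans subset_closure))
    by_cases hj : ∃ i, g i = j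
    · obtain ⟨i, rfl⟩ := hj
      refine ⟨v (.inl i), v (.inr i), U i, V i, hvcl _, hvcl _, hU i, hV i, hUV i,
        union_subset (hAU i) (hvsub (.inl i)), union_subset (hBV i) (hvsub (.inr i)), ?_⟩
      intro i' hi'
      -- Injectivity of `g` ensures that a pair is served by a single partition, so the pieces added
      -- to its two sides remain disjoint.
      rw [hg hi']
      exact ⟨subset_rfl, subset_rfl⟩
    · exact ⟨∅, ∅, U₀ j, V₀ j, isClosed_empty, isClosed_empty, hU₀ j, hV₀ j, hUV₀ j,
        by simpa using hAU₀ j, by simpa using hBV₀ j, fun i hi => (hj ⟨i, hi⟩).elim⟩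
  choose A' B' hA' hB' hAB' hAA' hBB' hv using key
  refine ⟨A', B', hA', hB', hAB', hAA', hBB', (measure_mono ?_).trans hGε⟩
  rintro x ⟨hxF, hx⟩
  by_contra hxG
  obtain ⟨i | i, hi⟩ := mem_iUnion.1 (hvcov ⟨hxF, hxG⟩)
  · exact mem_iInter.1 hx i (.inl ((hv (g i) i rfl).1 hi))
  · exact mem_iInter.1 hx i (.inr ((hv (g i) i rfl).2 hi))

/-- Countably many smallness requirements, each involving `n` of the pairs, can be met
simultaneously. -/
theorem exists_partitions_of_almostPartitionable {X : Type u} [MetricSpace X] {n : ℕ}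
    {J T : Type*} [Countable T] (g : T → Fin n → J) (hg : ∀ t, Function.Injective (g t))
    (μ : T → OuterMeasure X) (hμ : ∀ t, OpenRegular (μ t)) (F : T → Set X)
    (hF : ∀ t, IsClosed (F t)) (ε : T → ℝ≥0∞) (hε : ∀ t, ε t ≠ 0)
    (h : ∀ t, AlmostPartitionable n (μ t) (F t))
    (A B : J → Set X) (hA : ∀ j, IsClosed (A j)) (hB : ∀ j, IsClosed (B j))
    (hAB : ∀ j, A j ∩ B j = ∅) :
    ∃ L : J → Set X, (∀ j, IsPartitionBetween (A j) (B j) (L j)) ∧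
      ∀ t, μ t (F t ∩ ⋂ i, L (g t i)) ≤ ε t := by
  rcases isEmpty_or_nonempty T with hT | hT
  · choose L hL using fun j => exists_isPartitionBetween (hA j) (hB j) (hAB j)
    exact ⟨L, hL, fun t => (hT.false t).elim⟩
  obtain ⟨e, he⟩ := exists_surjective_nat T
  let State := {p : (J → Set X) × (J → Set X) //
    (∀ j, IsClosed (p.1 j)) ∧ (∀ j, IsClosed (p.2 j)) ∧ ∀ j, p.1 j ∩ p.2 j = ∅}
  have step : ∀ (m : ℕ) (p : State), ∃ q : State, (∀ j, p.1.1 j ⊆ interior (q.1.1 j)) ∧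
      (∀ j, p.1.2 j ⊆ interior (q.1.2 j)) ∧
      μ (e m) (F (e m) ∩ ⋂ i, (q.1.1 (g (e m) i) ∪ q.1.2 (g (e m) i))ᶜ) ≤ ε (e m) := by
    intro m p
    obtain ⟨A', B', h1, h2, h3, h4, h5, h6⟩ := (h (e m)).exists_enlarge (hμ _) (hF _) (hg _)
      p.2.1 p.2.2.1 p.2.2.2 (hε _)
    exact ⟨⟨(A', B'), h1, h2, h3⟩, h4, h5, h6⟩
  choose next hnA hnB hnμ using step
  let S : ℕ → State := fun m => Nat.rec ⟨(A, B), hA, hB, hAB⟩ (fun m p => next m p) m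
  have hSA : ∀ m j, (S m).1.1 j ⊆ interior ((S (m + 1)).1.1 j) := fun m => hnA m (S m)
  have hSB : ∀ m j, (S m).1.2 j ⊆ interior ((S (m + 1)).1.2 j) := fun m => hnB m (S m)
  have hmA : ∀ j, Monotone fun m => (S m).1.1 j :=
    fun j => monotone_nat_of_le_succ fun m => (hSA m j).trans interior_subset
  have hmB : ∀ j, Monotone fun m => (S m).1.2 j :=
    fun j => monotone_nat_of_le_succ fun m => (hSB m j).trans interior_subset
  -- The final partition omits every enlarged set, so it lies in the gap left at each stage and
  -- inherits all the smallness bounds.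
  refine ⟨fun j => ((⋃ m, interior ((S m).1.1 j)) ∪ ⋃ m, interior ((S m).1.2 j))ᶜ,
    fun j => ⟨_, _, isOpen_iUnion fun m => isOpen_interior, isOpen_iUnion fun m => isOpen_interior,
      (hSA 0 j).trans (subset_iUnion (fun m => interior ((S m).1.1 j)) 1),
      (hSB 0 j).trans (subset_iUnion (fun m => interior ((S m).1.2 j)) 1), ?_, rfl⟩, ?_⟩
  · refine eq_empty_of_forall_notMem ?_
    rintro x ⟨h1, h2⟩
    obtain ⟨m, hm⟩ := mem_iUnion.1 h1
    obtain ⟨k, hk⟩ := mem_iUnion.1 h2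
    have : x ∈ (S (max m k)).1.1 j ∩ (S (max m k)).1.2 j :=
      ⟨hmA j (le_max_left _ _) (interior_subset hm), hmB j (le_max_right _ _) (interior_subset hk)⟩
    rw [(S (max m k)).2.2.2 j] at this
    exact this
  · intro t
    obtain ⟨m, rfl⟩ := he t
    refine (measure_mono (inter_subset_inter_right _ (iInter_mono fun i => ?_))).trans (hnμ m (S m))
    refine compl_subset_compl.2 (union_subset_union ?_ ?_)
    · exact (hSA (m + 1) _).trans (subset_iUnion (fun m => interior ((S m).1.1 _)) (m + 2))
    · exact (hSB (m + 1) _).trans (subset_iUnion (fun m => interior ((S m).1.2 _)) (m + 2))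

theorem AlmostPartitionable.iUnion {X : Type u} [MetricSpace X] {n : ℕ} {μ : OuterMeasure X}
    (hμ : OpenRegular μ) {T : Type*} [Countable T] {F : T → Set X} (hF : ∀ t, IsClosed (F t))
    (h : ∀ t, AlmostPartitionable n μ (F t)) : AlmostPartitionable n μ (⋃ t, F t) := by
  intro ε hε A B hA hB hAB
  obtain ⟨δ, hδ, hδε⟩ := ENNReal.exists_pos_sum_of_countable' hε T
  obtain ⟨L, hL, hμL⟩ := exists_partitions_of_almostPartitionable (fun _ : T => id)
    (fun _ => Function.injective_id) (fun _ => μ) (fun _ => hμ) F hF δ (fun t => (hδ t).ne') h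
    A B hA hB hAB
  refine ⟨L, hL, ?_⟩
  rw [iUnion_inter]
  exact (measure_iUnion_le _).trans ((ENNReal.tsum_le_tsum hμL).trans hδε.le)

theorem AlmostPartitionable.mono {X : Type u} [TopologicalSpace X] {n : ℕ}
    {μ ν : OuterMeasure X} {F : Set X} (h : AlmostPartitionable n ν F) (hμν : ∀ A, μ A ≤ ν A) :
    AlmostPartitionable n μ F := fun ε hε A B hA hB hAB =>
  let ⟨L, hL, hμL⟩ := h ε hε A B hA hB hAB
  ⟨L, hL, (hμν _).trans hμL⟩

/-- Partitions of a subspace extend to partitions of the whole space. -/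
theorem exists_isPartitionBetween_of_subtype {X : Type u} [MetricSpace X] {F A B A' B' : Set X}
    (hA' : A ⊆ interior A') (hB' : B ⊆ interior B') (hAB : A' ∩ B' = ∅) (hA : IsClosed A)
    (hB : IsClosed B) {L : Set F}
    (hL : IsPartitionBetween (((↑) : F → X) ⁻¹' A') (((↑) : F → X) ⁻¹' B') L) :
    ∃ L', IsPartitionBetween A B L' ∧ F ∩ L' ⊆ (↑) '' L := by
  obtain ⟨U, V, hU, hV, hAU, hBV, hUV, rfl⟩ := hL
  obtain ⟨O, hO, rfl⟩ := isOpen_induced_iff.1 hU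
  obtain ⟨W, hW, rfl⟩ := isOpen_induced_iff.1 hV
  have hdis : ∀ x ∈ F, x ∈ O → x ∈ W → False := fun x hF hO hW => by
    have : (⟨x, hF⟩ : F) ∈ ((↑) ⁻¹' O ∩ (↑) ⁻¹' W : Set F) := ⟨hO, hW⟩
    rw [hUV] at this
    exact this
  have hABx : ∀ x, x ∈ A → x ∈ B → False := fun x h1 h2 => by
    have : x ∈ A' ∩ B' := ⟨interior_subset (hA' h1), interior_subset (hB' h2)⟩
    rw [hAB] at this
    exact this
  -- `A ∪ F ∩ O` and `B ∪ F ∩ W` are separated, although `F` need not be closed: neighbourhoods of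
  -- points of `B` meet `F` only inside `W`, and symmetrically. Complete normality then extends the
  -- partition.
  have sep : ∀ {P Q O W : Set X}, IsClosed P → (∀ x, x ∈ P → x ∈ Q → False) →
      (P ⊆ O ∪ Fᶜ) → (IsOpen W) → (∀ x ∈ F, x ∈ O → x ∈ W → False) →
      (∃ Q', Q ⊆ interior Q' ∧ ∀ x ∈ F, x ∈ Q' → x ∈ W) →
      closure (P ∪ F ∩ O) ∩ (Q ∪ F ∩ W) = ∅ := by
    intro P Q O W hP hPQ hPO hW hOW hQ
    obtain ⟨Q', hQ', hQW⟩ := hQ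
    refine eq_empty_of_forall_notMem ?_
    rw [closure_union, hP.closure_eq]
    rintro x ⟨hx | hx, hy | hy⟩
    · exact hPQ x hx hy
    · exact (hPO hx).elim (fun h => hOW x hy.1 h hy.2) (fun h => h hy.1)
    · obtain ⟨z, hz, hzF, hzO⟩ := mem_closure_iff.1 hx _ isOpen_interior (hQ' hy)
      exact hOW z hzF hzO (hQW z hzF (interior_subset hz))
    · obtain ⟨z, hz, hzF, hzO⟩ := mem_closure_iff.1 hx _ hW hy.2
      exact hOW z hzF hzO hz
  have hAO : ∀ x ∈ F, x ∈ A' → x ∈ O := fun x hF hx => hAU (a := ⟨x, hF⟩) hx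
  have hBW : ∀ x ∈ F, x ∈ B' → x ∈ W := fun x hF hx => hBV (a := ⟨x, hF⟩) hx
  have cov : ∀ {P P' O : Set X}, P ⊆ interior P' → (∀ x ∈ F, x ∈ P' → x ∈ O) → P ⊆ O ∪ Fᶜ :=
    fun {P P' O} h1 h2 x hx => or_iff_not_imp_right.2 fun hF =>
      h2 x (not_not.1 hF) (interior_subset (h1 hx))
  obtain ⟨U', V', hU', hV', hAU', hBV', hd⟩ := exists_open_of_separated
    (S := A ∪ F ∩ O) (T := B ∪ F ∩ W)
    (sep hA hABx (cov hA' hAO) hW hdis ⟨B', hB', hBW⟩)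
    (by
      rw [inter_comm]
      exact sep hB (fun x h1 h2 => hABx x h2 h1) (cov hB' hBW) hO
        (fun x hF h1 h2 => hdis x hF h2 h1) ⟨A', hA', hAO⟩)
  refine ⟨_, ⟨U', V', hU', hV', subset_union_left.trans hAU', subset_union_left.trans hBV', hd,
    rfl⟩, ?_⟩
  rintro x ⟨hF, hx⟩
  refine ⟨⟨x, hF⟩, fun h => hx ?_, rfl⟩
  exact h.imp (fun h => hAU' (.inr ⟨hF, h⟩)) (fun h => hBV' (.inr ⟨hF, h⟩))

theorem AlmostPartitionable.of_subtype {X : Type u} [MetricSpace X] {n : ℕ}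
    {μ : OuterMeasure X} {F : Set X}
    (h : AlmostPartitionable n (OuterMeasure.comap ((↑) : F → X) μ) univ) :
    AlmostPartitionable n μ F := by
  intro ε hε A B hA hB hAB
  have key : ∀ i, ∃ A' B' : Set X, IsClosed A' ∧ IsClosed B' ∧ A i ⊆ interior A' ∧
      B i ⊆ interior B' ∧ A' ∩ B' = ∅ := by
    intro i
    obtain ⟨L, U, V, hU, hV, hAU, hBV, hUV, _⟩ := exists_isPartitionBetween (hA i) (hB i) (hAB i)
    obtain ⟨P, hP, hAP, hPU⟩ := normal_exists_closure_subset (hA i) hU hAU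
    obtain ⟨Q, hQ, hBQ, hQV⟩ := normal_exists_closure_subset (hB i) hV hBV
    exact ⟨closure P, closure Q, isClosed_closure, isClosed_closure,
      hAP.trans (interior_maximal subset_closure hP), hBQ.trans (interior_maximal subset_closure hQ),
      subset_empty_iff.1 (hUV ▸ inter_subset_inter hPU hQV)⟩
  choose A' B' hA' hB' hAA' hBB' hd using key
  obtain ⟨L, hL, hμL⟩ := h ε hε (fun i => (↑) ⁻¹' A' i) (fun i => (↑) ⁻¹' B' i)
    (fun i => (hA' i).preimage continuous_subtype_val)
    (fun i => (hB' i).preimage continuous_subtype_val)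
    (fun i => by rw [← preimage_inter, hd i, preimage_empty])
  choose L' hL' hFL' using fun i =>
    exists_isPartitionBetween_of_subtype (hAA' i) (hBB' i) (hd i) (hA i) (hB i) (hL i)
  refine ⟨L', hL', le_trans (measure_mono ?_) hμL⟩
  rintro x ⟨hF, hx⟩
  refine ⟨⟨x, hF⟩, ⟨mem_univ _, mem_iInter.2 fun i => ?_⟩, rfl⟩
  obtain ⟨y, hy, hyx⟩ := hFL' i ⟨hF, mem_iInter.1 hx i⟩
  rwa [← Subtype.coe_injective (a₁ := y) (a₂ := ⟨x, hF⟩) hyx]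

/-! ### Partitions inside frontiers of a basis -/

/-- The open part of the disjointification of a sequence of sets. -/
def openDisjointed {X : Type u} [TopologicalSpace X] (V : ℕ → Set X) (k : ℕ) : Set X :=
  V k \ ⋃ j ∈ Finset.range k, closure (V j)

theorem isOpen_openDisjointed {X : Type u} [TopologicalSpace X] {V : ℕ → Set X}
    (hV : ∀ k, IsOpen (V k)) (k : ℕ) : IsOpen (openDisjointed V k) :=
  (hV k).sdiff (isClosed_biUnion_finset fun _ _ => isClosed_closure)

theorem notMem_openDisjointed_of_lt {X : Type u} [TopologicalSpace X] {V : ℕ → Set X} {j k : ℕ}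
    (hjk : j < k) {x : X} (hx : x ∈ V j) : x ∉ openDisjointed V k := fun h =>
  h.2 (mem_biUnion (Finset.mem_coe.2 (Finset.mem_range.2 hjk)) (subset_closure hx))

theorem openDisjointed_eq_of_mem {X : Type u} [TopologicalSpace X] {V : ℕ → Set X} {j k : ℕ}
    {x : X} (hj : x ∈ openDisjointed V j) (hk : x ∈ openDisjointed V k) : j = k := by
  rcases lt_trichotomy j k with h | h | h
  · exact (notMem_openDisjointed_of_lt h hj.1 hk).elim
  · exact h
  · exact (notMem_openDisjointed_of_lt h hk.1 hj).elim

/-- Take the least `k` with `x` in the closure of `V k`: either `x` is in `V k` and survives the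
removal of earlier closures, or it is on the frontier. -/
theorem exists_mem_openDisjointed_or_mem_frontier {X : Type u} [TopologicalSpace X]
    {V : ℕ → Set X} (hV : ∀ k, IsOpen (V k)) (hcov : ⋃ k, V k = univ) (x : X) :
    (∃ k, x ∈ openDisjointed V k) ∨ ∃ k, x ∈ frontier (V k) := by
  classical
  obtain ⟨k, hk⟩ := mem_iUnion.1 (hcov ▸ mem_univ x)
  have hex : ∃ k, x ∈ closure (V k) := ⟨k, subset_closure hk⟩
  by_cases hx : x ∈ V (Nat.find hex)
  · refine .inl ⟨Nat.find hex, hx, fun h => ?_⟩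
    simp only [Finset.mem_range, mem_iUnion, exists_prop] at h
    obtain ⟨j, hj, hxj⟩ := h
    exact Nat.find_min hex hj hxj
  · exact .inr ⟨Nat.find hex, (hV _).frontier_eq ▸ ⟨Nat.find_spec hex, hx⟩⟩

theorem exists_seq_cover {X : Type u} [TopologicalSpace X] [SecondCountableTopology X] [Nonempty X]
    {P : Set X → Prop} (hP : ∀ x, ∃ V, IsOpen V ∧ x ∈ V ∧ P V) :
    ∃ V : ℕ → Set X, (∀ k, IsOpen (V k)) ∧ (∀ k, P (V k)) ∧ ⋃ k, V k = univ := by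
  choose f hfo hfx hfP using hP
  obtain ⟨s, hs, hsu⟩ := TopologicalSpace.countable_cover_nhds fun x => (hfo x).mem_nhds (hfx x)
  have hne : s.Nonempty := by
    by_contra h
    simp only [not_nonempty_iff_eq_empty.1 h, mem_empty_iff_false, iUnion_of_empty,
      iUnion_empty] at hsu
    exact empty_ne_univ hsu
  obtain ⟨e, rfl⟩ := hs.exists_eq_range hne
  exact ⟨fun k => f (e k), fun k => hfo _, fun k => hfP _, by simpa using hsu⟩

/-- Disjoint closed sets admit a partition contained in countably many frontiers of members of
any given basis. -/
theorem exists_isPartitionBetween_subset_iUnion_frontier {X : Type u} [MetricSpace X]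
    [SecondCountableTopology X] [Nonempty X] {𝓤 : Set (Set X)} (h𝓤 : IsTopologicalBasis 𝓤)
    {A B : Set X} (hA : IsClosed A) (hB : IsClosed B) (hAB : A ∩ B = ∅) :
    ∃ (L : Set X) (V : ℕ → Set X), IsPartitionBetween A B L ∧ (∀ k, V k ∈ 𝓤) ∧
      L ⊆ ⋃ k, frontier (V k) := by
  obtain ⟨V, hVo, hV, hcov⟩ := exists_seq_cover (X := X)
    (P := fun V => V ∈ 𝓤 ∧ (closure V ∩ B = ∅ ∨ closure V ∩ A = ∅)) (by
      intro x
      -- Each point misses `A` or `B`, so a small basis element around it has closure missing that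
      -- same set.
      have hx : ∃ C, IsClosed C ∧ x ∉ C ∧ (C = B ∨ C = A) := by
        by_cases hxB : x ∈ B
        · exact ⟨A, hA, fun hxA => (hAB ▸ ⟨hxA, hxB⟩ : x ∈ (∅ : Set X)), .inr rfl⟩
        · exact ⟨B, hB, hxB, .inl rfl⟩
      obtain ⟨C, hC, hxC, hCAB⟩ := hx
      obtain ⟨O, hO, hxO, hOC⟩ := normal_exists_closure_subset isClosed_singleton hC.isOpen_compl
        (singleton_subset_iff.2 hxC)
      obtain ⟨V, hV, hxV, hVO⟩ := h𝓤.exists_subset_of_mem_open (singleton_subset_iff.1 hxO) hO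
      have hVC : closure V ∩ C = ∅ := disjoint_iff_inter_eq_empty.1
        (disjoint_left.2 fun y hy => hOC (closure_mono hVO hy))
      refine ⟨V, h𝓤.isOpen hV, hxV, hV, ?_⟩
      rcases hCAB with rfl | rfl
      exacts [.inl hVC, .inr hVC])
  set W := openDisjointed V with hW
  have sep : ∀ {P Q : Set X} {I : Set ℕ}, IsClosed P → P ∩ Q = ∅ →
      (∀ k ∈ I, closure (V k) ∩ Q = ∅) → (∀ k ∉ I, closure (V k) ∩ P = ∅) →
      closure (P ∪ ⋃ k ∈ I, W k) ∩ (Q ∪ ⋃ k ∈ Iᶜ, W k) = ∅ := by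
    intro P Q I hP hPQ hI hI'
    refine eq_empty_of_forall_notMem ?_
    rw [closure_union, hP.closure_eq]
    rintro x ⟨hx | hx, hy | hy⟩
    · exact (hPQ ▸ ⟨hx, hy⟩ : x ∈ (∅ : Set X))
    · obtain ⟨k, hk, hxk⟩ := mem_iUnion₂.1 hy
      exact (hI' k hk ▸ ⟨subset_closure hxk.1, hx⟩ : x ∈ (∅ : Set X))
    · obtain ⟨k, hk⟩ := mem_iUnion.1 (hcov ▸ mem_univ x)
      -- Pieces with index above `k` avoid `V k`, a neighbourhood of `x`. Only finitely many pieces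
      -- matter, and closure commutes with their union.
      have hx2 : x ∈ closure (⋃ j ∈ (Finset.range (k + 1) : Set ℕ) ∩ I, W j) := by
        rw [mem_closure_iff] at hx ⊢
        intro O hO hxO
        obtain ⟨z, ⟨hzO, hzV⟩, hz⟩ := hx (O ∩ V k) (hO.inter (hVo k)) ⟨hxO, hk⟩
        obtain ⟨j, hj, hzj⟩ := mem_iUnion₂.1 hz
        refine ⟨z, hzO, mem_iUnion₂.2 ⟨j, ⟨?_, hj⟩, hzj⟩⟩
        by_contra hjk
        refine notMem_openDisjointed_of_lt ?_ hzV hzj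
        simpa using hjk
      rw [((Finset.finite_toSet _).inter_of_left I).closure_biUnion] at hx2
      obtain ⟨j, hj, hxj⟩ := mem_iUnion₂.1 hx2
      exact (hI j hj.2 ▸ ⟨closure_mono sdiff_subset hxj, hy⟩ : x ∈ (∅ : Set X))
    · obtain ⟨k, hk, hxk⟩ := mem_iUnion₂.1 hy
      obtain ⟨z, hz, hz'⟩ := mem_closure_iff.1 hx _ (isOpen_openDisjointed hVo k) hxk
      obtain ⟨j, hj, hzj⟩ := mem_iUnion₂.1 hz'
      exact hk (openDisjointed_eq_of_mem hzj hz ▸ hj)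
  set I : Set ℕ := {k | closure (V k) ∩ B = ∅} with hI
  have hI' : ∀ k ∉ I, closure (V k) ∩ A = ∅ := fun k hk => (hV k).2.resolve_left hk
  obtain ⟨U, U', hU, hU', hAU, hBU', hd⟩ := exists_open_of_separated
    (sep (I := I) hA hAB (fun k hk => hk) hI')
    (by
      rw [inter_comm]
      have := sep (I := Iᶜ) hB (inter_comm A B ▸ hAB) hI' (fun k hk => not_not.1 hk)
      rwa [compl_compl] at this)
  refine ⟨_, V, ⟨U, U', hU, hU', subset_union_left.trans hAU, subset_union_left.trans hBU', hd,
    rfl⟩, fun k => (hV k).1, fun x hx => ?_⟩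
  rcases exists_mem_openDisjointed_or_mem_frontier hVo hcov x with ⟨k, hk⟩ | h
  · refine (hx ?_).elim
    by_cases hkI : k ∈ I
    · exact .inl (hAU (.inr (mem_iUnion₂.2 ⟨k, hkI, hk⟩)))
    · exact .inr (hBU' (.inr (mem_iUnion₂.2 ⟨k, hkI, hk⟩)))
  · exact mem_iUnion.2 h

/-! ### Induction on dimension -/

theorem AlmostPartitionable.of_isEmpty {X : Type u} [MetricSpace X] [IsEmpty X] (n : ℕ)
    (μ : OuterMeasure X) (F : Set X) : AlmostPartitionable n μ F := by
  intro ε _ A B hA hB hAB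
  choose L hL using fun i => exists_isPartitionBetween (hA i) (hB i) (hAB i)
  exact ⟨L, hL, by simp [Set.eq_empty_of_isEmpty]⟩

/-- The first pair gets a partition inside countably many frontiers; the remaining `n` pairs are
partitioned with small common part on the union of these closed sets. -/
theorem AlmostPartitionable.succ_of_basis {X : Type u} [MetricSpace X]
    [SecondCountableTopology X] {n : ℕ} {μ : OuterMeasure X} (hμ : OpenRegular μ)
    {𝓤 : Set (Set X)} (h𝓤 : IsTopologicalBasis 𝓤)
    (h : ∀ U ∈ 𝓤, AlmostPartitionable n μ (frontier U)) :
    AlmostPartitionable (n + 1) μ univ := by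
  rcases isEmpty_or_nonempty X with hX | hX
  · exact .of_isEmpty _ _ _
  intro ε hε A B hA hB hAB
  obtain ⟨L₀, V, hL₀, hV, hLV⟩ :=
    exists_isPartitionBetween_subset_iUnion_frontier h𝓤 (hA 0) (hB 0) (hAB 0)
  obtain ⟨L, hL, hμL⟩ := AlmostPartitionable.iUnion hμ (F := fun k => frontier (V k))
    (fun k => isClosed_frontier) (fun k => h _ (hV k)) ε hε (fun i => A i.succ)
    (fun i => B i.succ) (fun i => hA _) (fun i => hB _) (fun i => hAB _)
  refine ⟨Fin.cons L₀ L, Fin.cases hL₀ hL, (measure_mono ?_).trans hμL⟩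
  rintro x ⟨-, hx⟩
  exact ⟨hLV (mem_iInter.1 hx 0), mem_iInter.2 fun i => mem_iInter.1 hx i.succ⟩

theorem HasSmallInductiveDimensionLT.almostPartitionable {n : ℕ} :
    ∀ {X : Type u} [MetricSpace X] [SecondCountableTopology X],
      HasSmallInductiveDimensionLT X n → AlmostPartitionable n (⊤ : OuterMeasure X) univ := by
  induction n with
  | zero =>
    intro X _ _ h
    have := hasSmallInductiveDimensionLT_zero_iff.1 h
    exact .of_isEmpty _ _ _
  | succ n ih =>
    intro X _ _ h
    cases h with | succ _ s hs h =>
    refine AlmostPartitionable.succ_of_basis openRegular_top hs fun U hU => .of_subtype ?_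
    refine (ih (h U hU)).mono fun A => ?_
    rcases A.eq_empty_or_nonempty with rfl | hA
    · simp
    · simp [OuterMeasure.top_apply hA]

theorem hausdorffDim_le_coe_iff {X : Type u} [MetricSpace X] {A : Set X} {r : ℝ} (hr : 0 ≤ r) :
    hausdorffDim A ≤ (r : EReal) ↔ dimH A ≤ ENNReal.ofReal r := by
  have h : ((ENNReal.ofReal r : ℝ≥0∞) : EReal) = (r : EReal) := by
    rw [EReal.coe_ennreal_ofReal, max_eq_left hr]
  rw [hausdorffDim]
  split_ifs with hA
  · subst hA
    simp only [dimH_empty, zero_le, iff_true]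
    have : ((-1 : ℝ) : EReal) ≤ (r : EReal) := EReal.coe_le_coe_iff.2 (by linarith)
    rwa [EReal.coe_neg, EReal.coe_one] at this
  · rw [← h, EReal.coe_ennreal_le_coe_ennreal_iff]

theorem coe_succ_add_sub_one (n : ℕ) (t : ℝ) :
    ((((n + 1 : ℕ) : ℝ) + t : ℝ) : EReal) - 1 = ((n + t : ℝ) : EReal) := by
  rw [← EReal.coe_one, ← EReal.coe_sub]
  refine congrArg _ ?_
  push_cast
  ring

theorem almostPartitionable_of_indTopHausdorffDim_le {n : ℕ} :
    ∀ {X : Type u} [MetricSpace X] [SecondCountableTopology X] {r s : ℝ} (_ : 0 ≤ r) (_ : r < s)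
      (hs : 0 < s), indTopHausdorffDim n X ≤ ((n + r : ℝ) : EReal) →
      AlmostPartitionable n (contentMeasure X s hs) univ := by
  induction n with
  | zero =>
    intro X _ _ r s hr hrs hs h ε hε A B _ _ _
    -- With no pairs the common part is the whole space, so the claim is that the space itself has
    -- content zero.
    refine ⟨fun i => i.elim0, fun i => i.elim0, ?_⟩
    rw [indTopHausdorffDim, Nat.cast_zero, zero_add, hausdorffDim_le_coe_iff hr] at h
    rw [contentMeasure_apply]
    refine le_of_eq_of_le (hausdorffContent_eq_zero_of_dimH_lt hs ?_) bot_le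
    exact ((dimH_mono (subset_univ _)).trans h).trans_lt
      ((ENNReal.ofReal_lt_ofReal_iff hs).2 hrs)
  | succ n ih =>
    intro X _ _ r s hr hrs hs h
    rw [indTopHausdorffDim] at h
    split_ifs at h with hX
    · exact .of_isEmpty _ _ _
    -- The infimum is not yet known to be attained, so an intermediate `t` absorbs the loss.
    obtain ⟨t, hrt, hts⟩ := exists_between hrs
    have hlt : ((((n + 1 : ℕ) : ℝ) + r : ℝ) : EReal) < ((((n + 1 : ℕ) : ℝ) + t : ℝ) : EReal) :=
      EReal.coe_lt_coe_iff.2 (by linarith)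
    obtain ⟨d, ⟨𝓤, h𝓤, hd⟩, hdt⟩ := sInf_lt_iff.1 (h.trans_lt hlt)
    refine AlmostPartitionable.succ_of_basis (openRegular_contentMeasure hs) h𝓤 fun U hU =>
      .of_subtype ?_
    refine (ih (hr.trans hrt.le) hts hs ?_).mono fun A => ?_
    · refine (hd U hU).trans ((EReal.sub_le_sub hdt.le le_rfl).trans_eq (coe_succ_add_sub_one n t))
    · simpa using contentMeasure_image_coe_le hs (frontier U) A

/-! ### Decompositions -/

/-- The space has arbitrarily small open neighbourhoods whose frontiers miss `Z`. -/
def HasAvoidingBasis {X : Type u} [TopologicalSpace X] (Z : Set X) : Prop :=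
  ∀ (x : X) (U : Set X), IsOpen U → x ∈ U →
    ∃ V, IsOpen V ∧ x ∈ V ∧ V ⊆ U ∧ frontier V ∩ Z = ∅

theorem HasAvoidingBasis.isTopologicalBasis {X : Type u} [TopologicalSpace X] {Z : Set X}
    (h : HasAvoidingBasis Z) : IsTopologicalBasis {V | IsOpen V ∧ frontier V ∩ Z = ∅} :=
  isTopologicalBasis_of_isOpen_of_nhds (fun _ h => h.1) fun x U hx hU =>
    let ⟨V, hV, hxV, hVU, hVZ⟩ := h x U hU hx
    ⟨V, ⟨hV, hVZ⟩, hxV, hVU⟩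

theorem HasAvoidingBasis.preimage_coe {X : Type u} [TopologicalSpace X] {Z : Set X}
    (h : HasAvoidingBasis Z) (F : Set X) : HasAvoidingBasis (((↑) : F → X) ⁻¹' Z) := by
  intro x U hU hx
  obtain ⟨O, hO, rfl⟩ := isOpen_induced_iff.1 hU
  obtain ⟨V, hV, hxV, hVO, hVZ⟩ := h x O hO hx
  refine ⟨((↑) : F → X) ⁻¹' V, hV.preimage continuous_subtype_val, hxV, preimage_mono hVO, ?_⟩
  rw [← subset_empty_iff]
  refine (inter_subset_inter_left _
    (continuous_subtype_val.frontier_preimage_subset V)).trans ?_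
  rw [← preimage_inter, hVZ, preimage_empty]

/-- A basis whose frontiers miss `Z 0` leaves only `n` of the sets to cover each frontier. -/
theorem hasSmallInductiveDimensionLT_of_iUnion {n : ℕ} :
    ∀ {X : Type u} [TopologicalSpace X] {Z : Fin n → Set X}, (∀ i, HasAvoidingBasis (Z i)) →
      ⋃ i, Z i = univ → HasSmallInductiveDimensionLT X n := by
  induction n with
  | zero =>
    intro X _ Z _ hcov
    rw [hasSmallInductiveDimensionLT_zero_iff, ← univ_eq_empty_iff, ← hcov]
    simp
  | succ n ih =>
    intro X _ Z hZ hcov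
    refine .succ n _ (hZ 0).isTopologicalBasis fun V hV =>
      ih (fun i => (hZ i.succ).preimage_coe (frontier V)) ?_
    refine eq_univ_of_forall fun x => ?_
    obtain ⟨i, hi⟩ := mem_iUnion.1 (hcov ▸ mem_univ (x : X))
    refine i.cases (fun h0 => ?_) (fun i hi => mem_iUnion.2 ⟨i, hi⟩) hi
    exact (hV.2 ▸ ⟨x.2, h0⟩ : (x : X) ∈ (∅ : Set X)).elim

/-- `X` is the union of a set of Hausdorff dimension at most `r` and `n` sets of topological
dimension at most zero. -/
def HasDimDecomposition (n : ℕ) (r : ℝ) (X : Type u) [MetricSpace X] : Prop :=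
  ∃ (A : Set X) (Z : Fin n → Set X), dimH A ≤ ENNReal.ofReal r ∧
    (∀ i, HasAvoidingBasis (Z i)) ∧ A ∪ ⋃ i, Z i = univ

theorem dimH_preimage_coe_le {X : Type u} [MetricSpace X] (F A : Set X) :
    dimH (((↑) : F → X) ⁻¹' A) ≤ dimH A := by
  rw [← isometry_subtype_coe.dimH_image]
  exact dimH_mono (image_preimage_subset _ _)

theorem HasDimDecomposition.exists_basis {n : ℕ} {r : ℝ} {X : Type u} [MetricSpace X]
    (h : HasDimDecomposition (n + 1) r X) : ∃ 𝓤 : Set (Set X), IsTopologicalBasis 𝓤 ∧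
      ∀ U ∈ 𝓤, HasDimDecomposition n r (frontier U) := by
  obtain ⟨A, Z, hA, hZ, hcov⟩ := h
  refine ⟨_, (hZ 0).isTopologicalBasis, fun V hV => ⟨(↑) ⁻¹' A, fun i => (↑) ⁻¹' Z i.succ,
    (dimH_preimage_coe_le _ A).trans hA, fun i => (hZ i.succ).preimage_coe _, ?_⟩⟩
  refine eq_univ_of_forall fun x => ?_
  rcases (hcov ▸ mem_univ (x : X) : (x : X) ∈ A ∪ ⋃ i, Z i) with hx | hx
  · exact .inl hx
  obtain ⟨i, hi⟩ := mem_iUnion.1 hx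
  refine .inr (i.cases (fun h0 => ?_) (fun i hi => mem_iUnion.2 ⟨i, hi⟩) hi)
  exact (hV.2 ▸ ⟨x.2, h0⟩ : (x : X) ∈ (∅ : Set X)).elim

theorem HasDimDecomposition.indTopHausdorffDim_le {n : ℕ} {r : ℝ} (hr : 0 ≤ r) :
    ∀ {X : Type u} [MetricSpace X], HasDimDecomposition n r X →
      indTopHausdorffDim n X ≤ ((n + r : ℝ) : EReal) := by
  induction n with
  | zero =>
    rintro X _ ⟨A, Z, hA, -, hcov⟩
    rw [indTopHausdorffDim, Nat.cast_zero, zero_add, hausdorffDim_le_coe_iff hr]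
    rw [iUnion_of_empty, union_empty] at hcov
    exact hcov ▸ hA
  | succ n ih =>
    intro X _ h
    rw [indTopHausdorffDim]
    split_ifs with hX
    · have : ((-1 : ℝ) : EReal) ≤ ((((n + 1 : ℕ) : ℝ) + r : ℝ) : EReal) :=
        EReal.coe_le_coe_iff.2 (by push_cast; linarith [(Nat.cast_nonneg n : (0 : ℝ) ≤ n)])
      rwa [EReal.coe_neg, EReal.coe_one] at this
    · obtain ⟨𝓤, h𝓤, hU⟩ := h.exists_basis
      exact sInf_le ⟨𝓤, h𝓤, fun U hU' => (ih (hU U hU')).trans_eq (coe_succ_add_sub_one n r).symm⟩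

/-- Each of the `n` coordinates gets its own partitions for all pairs of a countable separating
family. `Z i` is what the partitions of coordinate `i` miss; a point in no `Z i` lies on one
partition from each coordinate, and countably many such intersections have dimension at most `r`. -/
theorem HasDimDecomposition.of_almostPartitionable {n : ℕ} {r : ℝ} (hr : 0 ≤ r) {X : Type u}
    [MetricSpace X] [SecondCountableTopology X]
    (h : ∀ (s : ℝ) (hs : 0 < s), r < s → AlmostPartitionable n (contentMeasure X s hs) univ) :
    HasDimDecomposition n r X := by
  let K := {p : countableBasis X × countableBasis X // closure (p.1 : Set X) ⊆ p.2}
  have hK : ∀ (x : X) (U : Set X), IsOpen U → x ∈ U →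
      ∃ p : K, x ∈ (p.1.1 : Set X) ∧ (p.1.2 : Set X) ⊆ U := by
    intro x U hU hx
    obtain ⟨V, hV, hxV, hVU⟩ :=
      (isBasis_countableBasis X).exists_subset_of_mem_open hx hU
    obtain ⟨O, hO, hxO, hOV⟩ := normal_exists_closure_subset isClosed_singleton
      ((isBasis_countableBasis X).isOpen hV) (singleton_subset_iff.2 hxV)
    obtain ⟨W, hW, hxW, hWO⟩ :=
      (isBasis_countableBasis X).exists_subset_of_mem_open (singleton_subset_iff.1 hxO) hO
    exact ⟨⟨(⟨W, hW⟩, ⟨V, hV⟩), (closure_mono hWO).trans hOV⟩, hxW, hVU⟩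
  have hpos : ∀ k : ℕ, 0 < r + 1 / ((k : ℝ) + 1) := fun k => by positivity
  have hKc : Countable K := inferInstance
  -- A requirement records one pair per coordinate, an exponent `r + 1 / (k + 1)` and a tolerance `1
  -- / (m + 1)`.
  obtain ⟨L, hL, hμ⟩ := exists_partitions_of_almostPartitionable
    (J := Fin n × K) (T := (Fin n → K) × ℕ × ℕ) (fun t i => (i, t.1 i))
    (fun t i j hij => congrArg Prod.fst hij)
    (fun t => contentMeasure X _ (hpos t.2.1)) (fun t => openRegular_contentMeasure _)
    (fun _ => univ) (fun _ => isClosed_univ) (fun t => ((t.2.2 : ℝ≥0∞) + 1)⁻¹) (fun t => by simp)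
    (fun t => h _ (hpos t.2.1) (lt_add_of_pos_right r (by positivity)))
    (fun j => closure (j.2.1.1 : Set X)) (fun j => (j.2.1.2 : Set X)ᶜ)
    (fun j => isClosed_closure)
    (fun j => ((isBasis_countableBasis X).isOpen j.2.1.2.2).isClosed_compl)
    (fun j => disjoint_iff_inter_eq_empty.1 (disjoint_compl_right_iff_subset.2 j.2.2))
  refine ⟨⋃ f : Fin n → K, ⋂ i, L (i, f i), fun i => (⋃ p, L (i, p))ᶜ, ?_, ?_, ?_⟩
  · rw [dimH_iUnion]
    refine iSup_le fun f => dimH_le_of_hausdorffContent_eq_zero hr fun k => ?_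
    rw [← contentMeasure_apply (hpos k)]
    refine le_antisymm (ge_of_tendsto' (x := atTop) (f := fun m : ℕ => ((m : ℝ≥0∞) + 1)⁻¹) ?_
      fun m => by simpa using hμ (f, k, m)) bot_le
    have := (ENNReal.tendsto_inv_nat_nhds_zero).comp (tendsto_add_atTop_nat 1)
    simpa [Function.comp_def] using this
  · intro i x U hU hx
    obtain ⟨p, hxp, hpU⟩ := hK x U hU hx
    obtain ⟨O, W, hO, hW, hAO, hBW, hOW, hLe⟩ := hL (i, p)
    have hOW' : ∀ y, y ∈ O → y ∈ W → False := fun y h1 h2 => (hOW ▸ ⟨h1, h2⟩ : y ∈ (∅ : Set X))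
    refine ⟨O, hO, hAO (subset_closure hxp), fun y hy => hpU ?_, ?_⟩
    · by_contra hyp
      exact hOW' y hy (hBW hyp)
    -- The frontier of the side `O` lies in the partition `L (i, p)`, which `Z i` avoids.
    · refine eq_empty_of_forall_notMem ?_
      rintro y ⟨hyO, hy⟩
      refine hy (mem_iUnion.2 ⟨p, ?_⟩)
      rw [hLe]
      rw [hO.frontier_eq] at hyO
      rintro (h | h)
      · exact hyO.2 h
      · obtain ⟨z, hzW, hzO⟩ := mem_closure_iff.1 hyO.1 W hW h
        exact hOW' z hzO hzW
  · refine eq_univ_of_forall fun x => or_iff_not_imp_right.2 fun hx => ?_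
    simp only [mem_iUnion, mem_compl_iff, not_exists, not_forall, not_not] at hx
    choose f hf using hx
    exact mem_iUnion.2 ⟨f, mem_iInter.2 hf⟩

/-! ### Finite covers and multiplicity -/

theorem HasAvoidingBasis.exists_disjoint_refinement {X : Type u} [TopologicalSpace X]
    [SecondCountableTopology X] [Nonempty X] {Z : Set X} (h : HasAvoidingBasis Z) {ι : Type*}
    {U : ι → Set X} (hU : IsOpenCoverFamily U) :
    ∃ W : ι → Set X, (∀ i, IsOpen (W i)) ∧ (∀ i, W i ⊆ U i) ∧ Z ⊆ ⋃ i, W i ∧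
      ∀ x i j, x ∈ W i → x ∈ W j → i = j := by
  obtain ⟨V, hVo, hV, hcov⟩ := exists_seq_cover (X := X)
    (P := fun V => frontier V ∩ Z = ∅ ∧ ∃ i, V ⊆ U i) (by
      intro x
      obtain ⟨i, hi⟩ := mem_iUnion.1 (hU.2 ▸ mem_univ x)
      obtain ⟨V, hV, hxV, hVU, hVZ⟩ := h x (U i) (hU.1 i) hi
      exact ⟨V, hV, hxV, hVZ, i, hVU⟩)
  choose hVZ f hf using hV
  refine ⟨fun i => ⋃ k ∈ f ⁻¹' {i}, openDisjointed V k, fun i => isOpen_biUnion fun k _ =>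
    isOpen_openDisjointed hVo k, fun i => iUnion₂_subset fun k hk => ?_, fun x hx => ?_, ?_⟩
  · rw [← mem_singleton_iff.1 hk]
    exact sdiff_subset.trans (hf k)
  · rcases exists_mem_openDisjointed_or_mem_frontier hVo hcov x with ⟨k, hk⟩ | ⟨k, hk⟩
    · exact mem_iUnion.2 ⟨f k, mem_iUnion₂.2 ⟨k, rfl, hk⟩⟩
    · exact (hVZ k ▸ ⟨hk, hx⟩ : x ∈ (∅ : Set X)).elim
  · intro x i j hi hj
    obtain ⟨k, hk, hxk⟩ := mem_iUnion₂.1 hi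
    obtain ⟨m, hm, hxm⟩ := mem_iUnion₂.1 hj
    rw [← mem_singleton_iff.1 hk, ← mem_singleton_iff.1 hm, openDisjointed_eq_of_mem hxk hxm]

theorem HasDimDecomposition.exists_refinement {n : ℕ} {r : ℝ} (hr : 0 ≤ r) {X : Type u}
    [MetricSpace X] [SecondCountableTopology X] [Nonempty X] (h : HasDimDecomposition n r X)
    {ε : ℝ} (hε : 0 < ε) {k : ℕ} {𝓤 : Fin k → Set X} (h𝓤 : IsOpenCoverFamily 𝓤) :
    ∃ (l : ℕ) (𝓥 : Fin l → Set X), IsOpenCoverFamily 𝓥 ∧ (∀ j, ∃ i, 𝓥 j ⊆ 𝓤 i) ∧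
      hausdorffContent (r + ε) (multiplyCovered (n + 1) 𝓥) ≤ ENNReal.ofReal ε := by
  obtain ⟨A, Z, hA, hZ, hcov⟩ := h
  have hs : 0 < r + ε := by linarith
  obtain ⟨G, hG, hAG, hμG⟩ := openRegular_contentMeasure hs A (ENNReal.ofReal ε) (by simpa using hε)
  rw [contentMeasure_apply, contentMeasure_apply, hausdorffContent_eq_zero_of_dimH_lt hs
    (hA.trans_lt ((ENNReal.ofReal_lt_ofReal_iff hs).2 (by linarith))), zero_add] at hμG
  choose W hWo hWU hZW hWd using fun i => (hZ i).exists_disjoint_refinement h𝓤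
  -- There are `n` disjoint layers covering the sets `Z i`, and the traces of the cover on a small
  -- open `G ⊇ A`. Outside `G` a point lies in at most one member per layer, hence in at most `n`
  -- members.
  let 𝓥 : (Fin n × Fin k) ⊕ Fin k → Set X := Sum.elim (fun p => W p.1 p.2) fun i => G ∩ 𝓤 i
  let e := (Fintype.equivFin ((Fin n × Fin k) ⊕ Fin k)).symm
  have hVcov : ∀ x, ∃ p, x ∈ 𝓥 p := by
    intro x
    rcases (hcov ▸ mem_univ x : x ∈ A ∪ ⋃ i, Z i) with hx | hx
    · obtain ⟨i, hi⟩ := mem_iUnion.1 (h𝓤.2 ▸ mem_univ x)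
      exact ⟨.inr i, hAG hx, hi⟩
    · obtain ⟨i, hi⟩ := mem_iUnion.1 hx
      obtain ⟨j, hj⟩ := mem_iUnion.1 (hZW i hi)
      exact ⟨.inl (i, j), hj⟩
  refine ⟨_, 𝓥 ∘ e, ⟨fun j => ?_, eq_univ_of_forall fun x => ?_⟩, fun j => ?_, ?_⟩
  · change IsOpen (𝓥 (e j))
    rcases e j with p | i
    exacts [hWo _ _, hG.inter (h𝓤.1 i)]
  · obtain ⟨p, hp⟩ := hVcov x
    exact mem_iUnion.2 ⟨e.symm p, by simpa using hp⟩
  · change ∃ i, 𝓥 (e j) ⊆ 𝓤 i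
    rcases e j with p | i
    exacts [⟨p.2, hWU _ _⟩, ⟨i, inter_subset_right⟩]
  · refine le_trans ?_ hμG
    rw [← contentMeasure_apply hs, ← contentMeasure_apply hs]
    refine measure_mono fun x hx => ?_
    by_contra hxG
    have hle : {j | x ∈ (𝓥 ∘ e) j}.encard ≤ n := by
      have hmem : ∀ j ∈ {j | x ∈ (𝓥 ∘ e) j}, ∃ p : Fin n × Fin k, e j = .inl p ∧ x ∈ W p.1 p.2 := by
        intro j hj
        change x ∈ 𝓥 (e j) at hj
        rcases hej : e j with p | i
        · rw [hej] at hj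
          exact ⟨p, rfl, hj⟩
        · rw [hej] at hj
          exact (hxG hj.1).elim
      choose p hp hxp using hmem
      have hinj : Function.Injective fun j : {j | x ∈ (𝓥 ∘ e) j} => (p j j.2).1 := by
        rintro ⟨j, hj⟩ ⟨j', hj'⟩ hjj'
        have h2 : (p j hj).2 = (p j' hj').2 := by
          refine hWd (p j hj).1 x _ _ (hxp j hj) ?_
          have := hxp j' hj'
          rwa [← show (p j hj).1 = (p j' hj').1 from hjj'] at this
        refine Subtype.ext (e.injective ?_)
        rw [hp j hj, hp j' hj', Prod.ext hjj' h2]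
      exact (ENat.card_le_card_of_injective hinj).trans_eq (by simp)
    have := (show ((n + 1 : ℕ) : ℕ∞) ≤ _ from hx).trans hle
    exact absurd (by exact_mod_cast this) (Nat.not_succ_le_self n)

/-- At most `n` points span a proper affine subspace of `ℝⁿ`, which is Lebesgue null; finitely many
of these cannot fill the open cube. -/
theorem exists_mem_Ioo_notMem_affineSpan {n l : ℕ} (w : Fin l → Fin n → ℝ) :
    ∃ t : Fin n → ℝ, (∀ i, t i ∈ Ioo (-1 : ℝ) 1) ∧
      ∀ S : Finset (Fin l), S.card ≤ n → t ∉ affineSpan ℝ (w '' S) := by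
  have hne : ∀ S : Finset (Fin l), S.card ≤ n → affineSpan ℝ (w '' S) ≠ ⊤ := by
    classical
    intro S hS htop
    obtain hc | ⟨m, hm⟩ : S.card = 0 ∨ ∃ m, S.card = m + 1 := by
      rcases S.card with _ | m
      exacts [.inl rfl, .inr ⟨m, rfl⟩]
    · rw [Finset.card_eq_zero] at hc
      subst hc
      simp at htop
    · have h1 := finrank_vectorSpan_image_finset_le ℝ w S hm
      rw [Finset.coe_image, ← direction_affineSpan, htop, AffineSubspace.direction_top,
        finrank_top, Module.finrank_fin_fun] at h1
      omega
  have hnull : volume (⋃ S ∈ {S : Finset (Fin l) | S.card ≤ n},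
      (affineSpan ℝ (w '' S) : Set (Fin n → ℝ))) = 0 :=
    (measure_biUnion_null_iff (Set.to_countable _)).2 fun S hS =>
      Measure.addHaar_affineSubspace volume _ (hne S hS)
  have hpos : volume (Set.pi univ fun _ : Fin n => Ioo (-1 : ℝ) 1) ≠ 0 := by
    rw [volume_pi_pi]
    simp [Finset.prod_const]
  obtain ⟨t, ht, ht'⟩ : ∃ t ∈ Set.pi univ (fun _ : Fin n => Ioo (-1 : ℝ) 1),
      t ∉ ⋃ S ∈ {S : Finset (Fin l) | S.card ≤ n}, (affineSpan ℝ (w '' S) : Set (Fin n → ℝ)) := by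
    by_contra! hcon
    exact hpos (measure_mono_null hcon hnull)
  refine ⟨t, fun i => ht i (mem_univ i), fun S hS hmem => ht' (mem_iUnion₂.2 ⟨S, hS, hmem⟩)⟩

/-- A finite open cover each of whose members misses a member of each of `n` pairs gives rise to
partitions with common part in the set of points covered more than `n` times. -/
theorem exists_partitions_subset_multiplyCovered {X : Type u} [MetricSpace X] {n l : ℕ}
    {A B : Fin n → Set X} {𝓥 : Fin l → Set X} (h𝓥 : IsOpenCoverFamily 𝓥)
    (hAB : ∀ j i, 𝓥 j ∩ A i = ∅ ∨ 𝓥 j ∩ B i = ∅) :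
    ∃ L : Fin n → Set X, (∀ i, IsPartitionBetween (A i) (B i) (L i)) ∧
      ⋂ i, L i ⊆ multiplyCovered (n + 1) 𝓥 := by
  classical
  obtain ⟨φ, hφ⟩ := PartitionOfUnity.exists_isSubordinate isClosed_univ 𝓥 h𝓥.1 h𝓥.2.ge
  have hsupp : ∀ j x, x ∉ 𝓥 j → φ j x = 0 := fun j x hx => by
    by_contra h
    exact hx (hφ j (subset_tsupport _ h))
  have hsum : ∀ x, ∑ j, φ j x = 1 := fun x => by
    rw [← finsum_eq_sum_of_fintype]
    exact φ.sum_eq_one (mem_univ x)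
  -- Vertices of the cube `{-1, 1}ⁿ`: the map `f` averaging them takes the value `1` on `A i` and
  -- `-1` on `B i` in coordinate `i`, with `t i` strictly between.
  let w : Fin l → Fin n → ℝ := fun j i => if (𝓥 j ∩ A i).Nonempty then 1 else -1
  let f : Fin n → X → ℝ := fun i x => ∑ j, φ j x * w j i
  have hf : ∀ i, Continuous (f i) := fun i =>
    continuous_finsetSum _ fun j _ => (φ j).continuous.mul continuous_const
  have hval : ∀ i x c, (∀ j, x ∈ 𝓥 j → w j i = c) → f i x = c := by
    intro i x c h
    have : ∀ j ∈ Finset.univ, φ j x * w j i = φ j x * c := fun j _ => by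
      by_cases hx : x ∈ 𝓥 j
      · rw [h j hx]
      · rw [hsupp j x hx, zero_mul, zero_mul]
    change ∑ j, φ j x * w j i = c
    rw [Finset.sum_congr rfl this, ← Finset.sum_mul, hsum, one_mul]
  obtain ⟨t, ht, htS⟩ := exists_mem_Ioo_notMem_affineSpan w
  refine ⟨fun i => {x | f i x = t i}, fun i => ⟨{x | t i < f i x}, {x | f i x < t i},
    isOpen_lt continuous_const (hf i), isOpen_lt (hf i) continuous_const, fun x hx => ?_,
    fun x hx => ?_, ?_, ?_⟩, fun x hx => ?_⟩
  · have := hval i x 1 fun j hj => if_pos ⟨x, hj, hx⟩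
    change t i < f i x
    rw [this]
    exact (ht i).2
  · have := hval i x (-1) fun j hj => if_neg fun hne => by
      rcases hAB j i with h | h
      · exact hne.ne_empty h
      · exact (h ▸ ⟨hj, hx⟩ : x ∈ (∅ : Set X))
    change f i x < t i
    rw [this]
    exact (ht i).1
  · exact eq_empty_of_forall_notMem fun x hx =>
      lt_asymm (show t i < f i x from hx.1) hx.2
  · ext x
    simp only [mem_ofPred_eq, mem_compl_iff, mem_union, not_or, not_lt]
    exact ⟨fun h => ⟨h.le, h.ge⟩, fun h => le_antisymm h.1 h.2⟩
  · by_contra hcon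
    set S : Finset (Fin l) := Finset.univ.filter fun j => x ∈ 𝓥 j with hS
    have hcard : S.card ≤ n := by
      have h1 : {j | x ∈ 𝓥 j}.encard = S.card := by
        rw [← Set.encard_coe_eq_coe_finsetCard]
        simp [hS]
      have h2 : ¬ ((n + 1 : ℕ) : ℕ∞) ≤ {j | x ∈ 𝓥 j}.encard := hcon
      rw [h1, Nat.cast_le] at h2
      omega
    -- At a point covered at most `n` times, `f` is an affine combination of at most `n` vertices,
    -- so it cannot equal `t`.
    refine htS S hcard ?_
    have hmem := affineCombination_mem_affineSpan_image (k := ℝ) (s := Finset.univ)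
      (w := fun j => φ j x) (hsum x) (s' := (S : Set (Fin l)))
      (fun j _ hj => hsupp j x (by simpa [hS] using hj)) w
    rw [Finset.affineCombination_eq_linear_combination _ _ _ (hsum x)] at hmem
    convert hmem using 1
    ext i
    rw [Finset.sum_apply]
    exact (show f i x = t i from mem_iInter.1 hx i).symm

theorem almostPartitionable_of_forall_cover {n : ℕ} {r : ℝ} (hr : 0 ≤ r) {X : Type u}
    [MetricSpace X]
    (h : ∀ ε : ℝ, 0 < ε → ∀ (k : ℕ) (𝓤 : Fin k → Set X), IsOpenCoverFamily 𝓤 →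
      ∃ (l : ℕ) (𝓥 : Fin l → Set X), IsOpenCoverFamily 𝓥 ∧ (∀ j, ∃ i, 𝓥 j ⊆ 𝓤 i) ∧
        hausdorffContent (r + ε) (multiplyCovered (n + 1) 𝓥) ≤ ENNReal.ofReal ε)
    {s : ℝ} (hs : 0 < s) (hrs : r < s) : AlmostPartitionable n (contentMeasure X s hs) univ := by
  intro ε hε A B hA hB hAB
  obtain ⟨q, hq0, hqε⟩ := ENNReal.lt_iff_exists_nnreal_btwn.1
    (lt_min (pos_iff_ne_zero.2 hε) (one_pos : (0 : ℝ≥0∞) < 1))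
  have hq : (0 : ℝ) < q := by exact_mod_cast hq0
  -- The bound `q < min ε 1` gives the tolerance and keeps the content below `1`; the bound `s - r`
  -- keeps the exponent at most `s`, to which it is then raised.
  have hδ : 0 < min (q : ℝ) (s - r) := lt_min hq (sub_pos.2 hrs)
  have hδq : ENNReal.ofReal (min (q : ℝ) (s - r)) ≤ q :=
    (ENNReal.ofReal_le_ofReal (min_le_left _ _)).trans_eq ENNReal.ofReal_coe_nnreal
  -- Each member omits one chosen set from every pair, a property inherited by refinements.
  let 𝓤 : (Fin n → Bool) → Set X := fun b => ⋂ i, (if b i then A i else B i)ᶜ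
  let e := (Fintype.equivFin (Fin n → Bool)).symm
  have h𝓤 : IsOpenCoverFamily (𝓤 ∘ e) := by
    refine ⟨fun j => isOpen_iInter_of_finite fun i => ?_, eq_univ_of_forall fun x => ?_⟩
    · split_ifs
      exacts [(hA i).isOpen_compl, (hB i).isOpen_compl]
    · classical
      refine mem_iUnion.2 ⟨e.symm fun i => decide (x ∉ A i), ?_⟩
      simp only [Function.comp_apply, Equiv.apply_symm_apply, 𝓤, mem_iInter]
      intro i
      by_cases hx : x ∈ A i
      · simpa [hx] using fun hxB => (hAB i ▸ ⟨hx, hxB⟩ : x ∈ (∅ : Set X))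
      · simp [hx]
  obtain ⟨l, 𝓥, h𝓥, href, hcont⟩ := h _ hδ _ _ h𝓤
  obtain ⟨L, hL, hsub⟩ := exists_partitions_subset_multiplyCovered (A := A) (B := B) h𝓥 (by
    intro j i
    obtain ⟨b, hb⟩ := href j
    have hbi := hb.trans (iInter_subset _ i)
    rw [← disjoint_iff_inter_eq_empty, ← disjoint_iff_inter_eq_empty,
      ← subset_compl_iff_disjoint_right, ← subset_compl_iff_disjoint_right]
    split_ifs at hbi
    exacts [.inl hbi, .inr hbi])
  refine ⟨L, hL, ?_⟩
  rw [univ_inter]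
  refine (measure_mono hsub).trans ?_
  rw [contentMeasure_apply]
  refine (hausdorffContent_le_of_le (add_pos_of_nonneg_of_pos hr hδ) ?_ ?_ hcont).trans ?_
  · linarith [min_le_right (q : ℝ) (s - r)]
  · exact hδq.trans_lt (hqε.trans_le (min_le_right _ _))
  · exact hδq.trans (hqε.le.trans (min_le_left _ _))

/-! ### Exact partitions -/

theorem almostPartitionable_of_forall_partition {n : ℕ} {r : ℝ} (hr : 0 ≤ r) {X : Type u}
    [MetricSpace X] (h : ∀ A B : Fin n → Set X,
      (∀ i, IsClosed (A i)) → (∀ i, IsClosed (B i)) → (∀ i, A i ∩ B i = ∅) →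
      ∃ L : Fin n → Set X, (∀ i, IsPartitionBetween (A i) (B i) (L i)) ∧
        hausdorffDim (⋂ i, L i) ≤ (r : EReal))
    {s : ℝ} (hs : 0 < s) (hrs : r < s) : AlmostPartitionable n (contentMeasure X s hs) univ := by
  intro ε _ A B hA hB hAB
  obtain ⟨L, hL, hdim⟩ := h A B hA hB hAB
  rw [hausdorffDim_le_coe_iff hr] at hdim
  refine ⟨L, hL, ?_⟩
  rw [contentMeasure_apply, univ_inter, hausdorffContent_eq_zero_of_dimH_lt hs
    (hdim.trans_lt ((ENNReal.ofReal_lt_ofReal_iff hs).2 hrs))]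
  exact bot_le

/-- Partitions whose common part misses a given subspace of small topological dimension. -/
theorem exists_partitions_subset_of_compl_dimensionLT {n : ℕ} {X : Type u} [MetricSpace X]
    [SecondCountableTopology X] {S : Set X}
    (hS : HasSmallInductiveDimensionLT (Sᶜ : Set X) n) (A B : Fin n → Set X)
    (hA : ∀ i, IsClosed (A i)) (hB : ∀ i, IsClosed (B i)) (hAB : ∀ i, A i ∩ B i = ∅) :
    ∃ L : Fin n → Set X, (∀ i, IsPartitionBetween (A i) (B i) (L i)) ∧ ⋂ i, L i ⊆ S := by
  have h : AlmostPartitionable n (⊤ : OuterMeasure X) Sᶜ := by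
    refine .of_subtype (hS.almostPartitionable.mono fun T => ?_)
    rcases T.eq_empty_or_nonempty with rfl | hT
    · simp
    · simp [OuterMeasure.top_apply hT]
  -- Any finite tolerance would do: a set of finite `⊤`-measure is empty.
  obtain ⟨L, hL, hμ⟩ := h 1 one_ne_zero A B hA hB hAB
  refine ⟨L, hL, fun x hx => ?_⟩
  by_contra hxS
  rw [OuterMeasure.top_apply (s := Sᶜ ∩ ⋂ i, L i) ⟨x, hxS, hx⟩] at hμ
  exact absurd hμ (by simp)

/-! ### Comparison of dimensions and the main theorem -/

theorem topDim_le_sub_one_iff {n : ℕ} {X : Type u} [TopologicalSpace X] :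
    topDim X ≤ (n : EReal) - 1 ↔ HasSmallInductiveDimensionLT X n := by
  have hn : (n : EReal) - 1 = ((n - 1 : ℝ) : EReal) := by
    rw [EReal.coe_sub, EReal.coe_one, EReal.coe_natCast]
  rw [← smallInductiveDimension_lt_iff, topDim, hn]
  generalize smallInductiveDimension X = d
  induction d with
  | bot =>
    have : ((-1 : ℝ) : EReal) ≤ ((n - 1 : ℝ) : EReal) :=
      EReal.coe_le_coe_iff.2 (by linarith [(Nat.cast_nonneg n : (0 : ℝ) ≤ n)])
    rw [EReal.coe_neg, EReal.coe_one] at this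
    exact iff_of_true this (WithBot.bot_lt_coe _)
  | coe k =>
    induction k with
    | top =>
      refine iff_of_false (fun h => ?_) (fun h => ?_)
      · change (((⊤ : ℕ∞) : ℝ≥0∞) : EReal) ≤ _ at h
        rw [ENat.toENNReal_top, EReal.coe_ennreal_top] at h
        exact absurd h (not_le.2 (EReal.coe_lt_top _))
      · exact not_top_lt (WithBot.coe_lt_coe.1 h)
    | coe m =>
      have h1 : (((m : ℕ∞) : ℝ≥0∞) : EReal) = ((m : ℝ) : EReal) := by
        rw [ENat.toENNReal_coe, ← ENNReal.ofReal_natCast, EReal.coe_ennreal_ofReal,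
          max_eq_left (Nat.cast_nonneg m)]
      change (((m : ℕ∞) : ℝ≥0∞) : EReal) ≤ _ ↔ _
      rw [h1, EReal.coe_le_coe_iff]
      have h2 : (((m : ℕ∞) : WithBot ℕ∞) < (n : WithBot ℕ∞)) ↔ m < n := by norm_cast
      rw [h2, le_sub_iff_add_le]
      norm_cast

/-- The base case rests on the convention that the empty set has dimension `-1`: a negative
Hausdorff dimension means an empty space. The contrapositive gives the lower bound `n`, hence `r ≥
0`. -/
theorem hasSmallInductiveDimensionLT_of_indTopHausdorffDim_lt {n : ℕ} :
    ∀ {X : Type u} [MetricSpace X], indTopHausdorffDim n X < n →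
      HasSmallInductiveDimensionLT X n := by
  induction n with
  | zero =>
    intro X _ h
    rw [hasSmallInductiveDimensionLT_zero_iff, ← univ_eq_empty_iff]
    by_contra hX
    rw [indTopHausdorffDim, hausdorffDim, if_neg hX] at h
    exact absurd h (not_lt.2 (by simpa using EReal.coe_ennreal_nonneg _))
  | succ n ih =>
    intro X _ h
    rw [indTopHausdorffDim] at h
    split_ifs at h with hX
    · infer_instance
    obtain ⟨d, ⟨𝓤, h𝓤, hd⟩, hdn⟩ := sInf_lt_iff.1 h
    refine .succ n 𝓤 h𝓤 fun U hU => ih ((hd U hU).trans_lt ?_)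
    refine EReal.sub_lt_of_lt_add ?_
    exact_mod_cast hdn

theorem exists_nonneg_eq_of_le {n : ℕ} {d : EReal} (h : (n : EReal) ≤ d) (hd : d ≠ ⊤) :
    ∃ r : ℝ, 0 ≤ r ∧ d = ((n + r : ℝ) : EReal) ∧ d - n = (r : EReal) := by
  induction d with
  | bot => exact absurd h (not_le.2 (EReal.bot_lt_coe _))
  | top => exact absurd rfl hd
  | coe d =>
    have h' : (n : ℝ) ≤ d := by
      rw [← EReal.coe_natCast] at h
      exact EReal.coe_le_coe_iff.1 h
    refine ⟨d - n, sub_nonneg.2 h', by rw [add_sub_cancel], ?_⟩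
    rw [EReal.coe_sub, EReal.coe_natCast]

theorem theorem4p3 (n : ℕ) (hn : 1 ≤ n) (X : Type u) [MetricSpace X] [SeparableSpace X]
    (hX : (n : EReal) ≤ topDim X) :
    IsLeast (paramTop n X) (indTopHausdorffDim n X) ∧
    IsLeast (paramDecomp n X) (indTopHausdorffDim n X) ∧
    IsLeast (paramPart n X) (indTopHausdorffDim n X) ∧
    IsLeast (paramCover n X) (indTopHausdorffDim n X) := by
  have : SecondCountableTopology X := UniformSpace.secondCountable_of_separable X
  have hLT : ¬ HasSmallInductiveDimensionLT X n := by
    rw [← topDim_le_sub_one_iff, not_le]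
    refine lt_of_lt_of_le ?_ hX
    rw [← EReal.coe_natCast, ← EReal.coe_one, ← EReal.coe_sub, EReal.coe_lt_coe_iff]
    linarith
  have hne : Nonempty X := by
    by_contra h
    rw [not_nonempty_iff] at h
    exact hLT inferInstance
  have hnD : (n : EReal) ≤ indTopHausdorffDim n X := by
    by_contra h
    exact hLT (hasSmallInductiveDimensionLT_of_indTopHausdorffDim_lt (not_le.1 h))
  have hpart : ∀ {A : Set X} {r : ℝ}, 0 ≤ r → dimH A ≤ ENNReal.ofReal r →
      HasSmallInductiveDimensionLT (Aᶜ : Set X) n → ∀ S T : Fin n → Set X,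
      (∀ i, IsClosed (S i)) → (∀ i, IsClosed (T i)) → (∀ i, S i ∩ T i = ∅) →
      ∃ L : Fin n → Set X, (∀ i, IsPartitionBetween (S i) (T i) (L i)) ∧
        hausdorffDim (⋂ i, L i) ≤ (r : EReal) := by
    intro A r hr hA hAc S T hS hT hST
    obtain ⟨L, hL, hLA⟩ := exists_partitions_subset_of_compl_dimensionLT hAc S T hS hT hST
    exact ⟨L, hL, (hausdorffDim_le_coe_iff hr).2 ((dimH_mono hLA).trans hA)⟩
  -- A finite value `n + r` is turned into a decomposition at exactly `r`; this witnesses membership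
  -- in all four sets.
  have hdec : indTopHausdorffDim n X ≠ ⊤ → ∃ r : ℝ, 0 ≤ r ∧
      indTopHausdorffDim n X = ((n + r : ℝ) : EReal) ∧
      indTopHausdorffDim n X - n = (r : EReal) ∧ HasDimDecomposition n r X := by
    intro htop
    obtain ⟨r, hr, h1, h2⟩ := exists_nonneg_eq_of_le hnD htop
    exact ⟨r, hr, h1, h2, .of_almostPartitionable hr fun s hs hrs =>
      almostPartitionable_of_indTopHausdorffDim_le hr hrs hs h1.le⟩
  have hcompl : ∀ {r : ℝ}, HasDimDecomposition n r X → ∃ A : Set X,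
      dimH A ≤ ENNReal.ofReal r ∧ HasSmallInductiveDimensionLT (Aᶜ : Set X) n := by
    rintro r ⟨A, Z, hA, hZ, hcov⟩
    refine ⟨A, hA, hasSmallInductiveDimensionLT_of_iUnion
      (fun i => (hZ i).preimage_coe Aᶜ) (eq_univ_of_forall fun x => ?_)⟩
    have hx : (x : X) ∈ ⋃ i, Z i :=
      (hcov ▸ mem_univ (x : X) : (x : X) ∈ A ∪ ⋃ i, Z i).resolve_left x.2
    simpa using hx
  refine ⟨⟨?_, ?_⟩, ⟨?_, ?_⟩, ⟨?_, ?_⟩, ⟨?_, ?_⟩⟩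
  · refine or_iff_not_imp_left.2 fun htop => ?_
    obtain ⟨r, hr, h1, -, hd⟩ := hdec htop
    obtain ⟨m, rfl⟩ := Nat.exists_eq_add_of_le' hn
    obtain ⟨𝓤, h𝓤, hU⟩ := hd.exists_basis
    refine ⟨𝓤, h𝓤, fun U hU' => ?_⟩
    rw [h1, coe_succ_add_sub_one]
    exact (hU U hU').indTopHausdorffDim_le hr
  · rintro d (rfl | ⟨𝓤, h𝓤, hU⟩)
    · exact le_top
    obtain ⟨m, rfl⟩ := Nat.exists_eq_add_of_le' hn
    rw [indTopHausdorffDim, if_neg (not_isEmpty_iff.2 hne)]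
    exact sInf_le ⟨𝓤, h𝓤, hU⟩
  · refine or_iff_not_imp_left.2 fun htop => ⟨hnD, ?_⟩
    obtain ⟨r, hr, -, h2, hd⟩ := hdec htop
    obtain ⟨A, hA, hAc⟩ := hcompl hd
    exact ⟨A, h2 ▸ (hausdorffDim_le_coe_iff hr).2 hA, topDim_le_sub_one_iff.2 hAc⟩
  · rintro d (rfl | ⟨hnd, A, hA, hAc⟩)
    · exact le_top
    rcases eq_or_ne d ⊤ with rfl | htop
    · exact le_top
    obtain ⟨r, hr, h1, h2⟩ := exists_nonneg_eq_of_le hnd htop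
    rw [h2, hausdorffDim_le_coe_iff hr] at hA
    rw [h1]
    exact (HasDimDecomposition.of_almostPartitionable hr fun s hs hrs =>
      almostPartitionable_of_forall_partition hr
        (hpart hr hA (topDim_le_sub_one_iff.1 hAc)) hs hrs).indTopHausdorffDim_le hr
  · refine or_iff_not_imp_left.2 fun htop => ⟨hnD, ?_⟩
    obtain ⟨r, hr, -, h2, hd⟩ := hdec htop
    obtain ⟨A, hA, hAc⟩ := hcompl hd
    rw [h2]
    exact hpart hr hA hAc
  · rintro d (rfl | ⟨hnd, h⟩)
    · exact le_top
    rcases eq_or_ne d ⊤ with rfl | htop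
    · exact le_top
    obtain ⟨r, hr, h1, h2⟩ := exists_nonneg_eq_of_le hnd htop
    rw [h2] at h
    rw [h1]
    exact (HasDimDecomposition.of_almostPartitionable hr fun s hs hrs =>
      almostPartitionable_of_forall_partition hr h hs hrs).indTopHausdorffDim_le hr
  · refine or_iff_not_imp_left.2 fun htop => ?_
    obtain ⟨r, hr, h1, -, hd⟩ := hdec htop
    refine ⟨n + r, h1, by linarith, fun ε hε k 𝓤 h𝓤 => ?_⟩
    rw [add_sub_cancel_left]
    exact hd.exists_refinement hr hε h𝓤
  · rintro d (rfl | ⟨d, rfl, hnd, h⟩)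
    · exact le_top
    have hr : 0 ≤ d - n := sub_nonneg.2 hnd
    have := (HasDimDecomposition.of_almostPartitionable hr fun s hs hrs =>
      almostPartitionable_of_forall_cover hr h hs hrs).indTopHausdorffDim_le hr
    rwa [add_sub_cancel] at this
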